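/- For a smooth compactly supported function $g:\mathbb R\to\mathbb C$, let $$\hat g(x)=(2\pi)^{-1/2}\int_{-\infty}^{\infty}e^{-ixy}g(y)\,dy,\qquad x\in\mathbb R,$$ be its Fourier transform. Then for every $g\in C_0^\infty(\mathbb R)$ the function $\hat g$ belongs to $L^2(\mathbb R)$, the series below converge for every $t\in\mathbb R$, and $$\lim_{t\to+\infty}\sum_{n=0}^{\infty}(2n+1)^{-1/2}\,\bigl|\hat g\bigl(t-\sqrt{2n+1}\bigr)\bigr|^2=\|\hat g\|_{L^2(\mathbb R)}^2,$$ $$\lim_{t\to-\infty}\sum_{n=0}^{\infty}(2n+1)^{-1/2}\,\bigl|\hat g\bigl(t+\sqrt{2n+1}\bigr)\bigr|^2=\|\hat g\|_{L^2(\mathbb R)}^2.$$ -/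

import Mathlib

open MeasureTheory Filter Topology
open scoped ContDiff

/-- The unitary Fourier transform on the real line,
`ĝ(x) = (2π)^{-1/2} ∫ e^{-i x y} g(y) dy`. -/
noncomputable def unitaryFourier (g : ℝ → ℂ) (x : ℝ) : ℂ :=
  (((2 * Real.pi) ^ (-(1 / 2) : ℝ) : ℝ) : ℂ) *
    ∫ y : ℝ, Complex.exp (-(Complex.I * (x : ℂ) * (y : ℂ))) * g y

/-! Consecutive nodes a_n = √(2n+1) differ by 2/(a_{n+1} + a_n), asymptotically 1/a_n, so the series
is nearly a Riemann sum of f = |ĝ|² whose mesh shrinks where t is large. `hasSum_sqrtNode` makes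
this exact: the sum is the integral of a weighted step function. In the variable u = t - s these
steps converge pointwise to f under a bound C'/(1 + u²), so dominated convergence gives
`tendsto_tsum_sqrtNode`. Continuity and decay of f hold because ĝ is a rescaled Schwartz function.
-/

/-- The nodes `√(2n+1)`. -/
noncomputable def sqrtNode (n : ℕ) : ℝ := Real.sqrt (2 * (n : ℝ) + 1)

/-- The index `n` with `√(2n+1) ≤ s < √(2n+3)`, for `s ≥ 1`. -/
noncomputable def nodeIndex (s : ℝ) : ℕ := ⌊(s ^ 2 - 1) / 2⌋₊

/-- The ratio of `(2n+1)^{-1/2}` to the gap between consecutive nodes. -/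
noncomputable def nodeWeight (n : ℕ) : ℝ :=
  (sqrtNode (n + 1) + sqrtNode n) / (2 * sqrtNode n)

lemma sqrtNode_sq (n : ℕ) : sqrtNode n ^ 2 = 2 * (n : ℝ) + 1 :=
  Real.sq_sqrt (by positivity)

lemma one_le_sqrtNode (n : ℕ) : 1 ≤ sqrtNode n :=
  Real.one_le_sqrt.2 (by linarith [n.cast_nonneg (α := ℝ)])

lemma sqrtNode_strictMono : StrictMono sqrtNode := fun m n h =>
  Real.sqrt_lt_sqrt (by positivity) (by have : (m : ℝ) < n := by exact_mod_cast h
                                        linarith)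

lemma sqrtNode_gap_mul (n : ℕ) :
    (sqrtNode (n + 1) - sqrtNode n) * (sqrtNode (n + 1) + sqrtNode n) = 2 := by
  have h := sqrtNode_sq n
  have h' := sqrtNode_sq (n + 1)
  push_cast at h'
  linear_combination h' - h

lemma sqrtNode_gap_le (n : ℕ) : sqrtNode (n + 1) - sqrtNode n ≤ 1 / sqrtNode n := by
  have h := sqrtNode_gap_mul n
  have h0 := one_le_sqrtNode n
  have h1 := sqrtNode_strictMono n.lt_succ_self
  rw [le_div_iff₀ (by linarith)]
  simp only [Nat.succ_eq_add_one] at h1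
  nlinarith

lemma sqrtNode_gap_le_one (n : ℕ) : sqrtNode (n + 1) - sqrtNode n ≤ 1 :=
  (sqrtNode_gap_le n).trans (by
    rw [div_le_one (by linarith [one_le_sqrtNode n])]; exact one_le_sqrtNode n)

lemma tendsto_sqrtNode : Tendsto sqrtNode atTop atTop :=
  Real.tendsto_sqrt_atTop.comp (tendsto_atTop_add_const_right _ _
    (tendsto_natCast_atTop_atTop.const_mul_atTop two_pos))

lemma tendsto_sqrtNode_gap :
    Tendsto (fun n => sqrtNode (n + 1) - sqrtNode n) atTop (𝓝 0) :=
  squeeze_zero (fun n => sub_nonneg.2 (sqrtNode_strictMono n.lt_succ_self).le) sqrtNode_gap_le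
    (tendsto_sqrtNode.inv_tendsto_atTop.congr fun n => (one_div (sqrtNode n)).symm)

lemma nodeWeight_eq (n : ℕ) :
    nodeWeight n = 1 + (sqrtNode (n + 1) - sqrtNode n) * (1 / 2) * (sqrtNode n)⁻¹ := by
  have := one_le_sqrtNode n
  unfold nodeWeight
  field_simp
  ring

lemma nodeWeight_nonneg (n : ℕ) : 0 ≤ nodeWeight n := by
  have := one_le_sqrtNode n
  have := one_le_sqrtNode (n + 1)
  unfold nodeWeight
  positivity

lemma nodeWeight_le_two (n : ℕ) : nodeWeight n ≤ 2 := by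
  have := one_le_sqrtNode n
  have := sqrtNode_gap_le_one n
  unfold nodeWeight
  rw [div_le_iff₀ (by linarith)]
  linarith

lemma tendsto_nodeWeight : Tendsto nodeWeight atTop (𝓝 1) := by
  have h := ((tendsto_sqrtNode_gap.mul_const (1 / 2)).mul
    tendsto_sqrtNode.inv_tendsto_atTop).const_add 1
  simp only [zero_mul, add_zero] at h
  exact h.congr fun n => (nodeWeight_eq n).symm

/-- This makes the integral of the step over one cell exactly one term of the series. -/
lemma gap_mul_nodeWeight (n : ℕ) :
    (sqrtNode (n + 1) - sqrtNode n) * nodeWeight n = (sqrtNode n)⁻¹ := by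
  have := one_le_sqrtNode n
  unfold nodeWeight
  rw [← mul_div_assoc, sqrtNode_gap_mul]
  field_simp

lemma nodeIndex_eq_iff {s : ℝ} (hs : 1 ≤ s) (n : ℕ) :
    nodeIndex s = n ↔ s ∈ Set.Ico (sqrtNode n) (sqrtNode (n + 1)) := by
  have h0 : 0 ≤ (s ^ 2 - 1) / 2 := by nlinarith
  rw [nodeIndex, Nat.floor_eq_iff h0, Set.mem_Ico, sqrtNode, sqrtNode,
    Real.sqrt_le_left (by linarith), Real.lt_sqrt (by linarith)]
  push_cast
  constructor <;> rintro ⟨h1, h2⟩ <;> constructor <;> linarith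

lemma mem_Ico_nodeIndex {s : ℝ} (hs : 1 ≤ s) :
    s ∈ Set.Ico (sqrtNode (nodeIndex s)) (sqrtNode (nodeIndex s + 1)) :=
  (nodeIndex_eq_iff hs _).1 rfl

lemma measurable_nodeIndex : Measurable nodeIndex := by
  unfold nodeIndex
  exact Nat.measurable_floor.comp (by fun_prop)

lemma tendsto_nodeIndex : Tendsto nodeIndex atTop atTop := by
  refine tendsto_nat_floor_atTop.comp (Tendsto.atTop_div_const two_pos ?_)
  exact tendsto_atTop_add_const_right _ _ (tendsto_pow_atTop two_ne_zero)

lemma iUnion_Ico_sqrtNode : ⋃ n, Set.Ico (sqrtNode n) (sqrtNode (n + 1)) = Set.Ici 1 := by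
  ext s
  simp only [Set.mem_iUnion, Set.mem_Ici]
  exact ⟨fun ⟨n, hn⟩ => (one_le_sqrtNode n).trans hn.1, fun hs => ⟨_, mem_Ico_nodeIndex hs⟩⟩

lemma tendsto_sub_sqrtNode_nodeIndex :
    Tendsto (fun s => s - sqrtNode (nodeIndex s)) atTop (𝓝 0) := by
  refine squeeze_zero' ?_ ?_ (tendsto_sqrtNode_gap.comp tendsto_nodeIndex)
  · filter_upwards [eventually_ge_atTop 1] with s hs
    exact sub_nonneg.2 (mem_Ico_nodeIndex hs).1
  · filter_upwards [eventually_ge_atTop 1] with s hs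
    exact sub_le_sub_right (mem_Ico_nodeIndex hs).2.le _

/-- The step function whose integral over `[1, ∞)` is the Riemann-type sum of `f`. -/
noncomputable def nodeStep (f : ℝ → ℝ) (t s : ℝ) : ℝ :=
  nodeWeight (nodeIndex s) * f (t - sqrtNode (nodeIndex s))

lemma measurable_nodeStep (f : ℝ → ℝ) (t : ℝ) :
    Measurable (nodeStep f t) := by
  have h : Measurable fun n : ℕ => nodeWeight n * f (t - sqrtNode n) := measurable_of_countable _
  exact h.comp measurable_nodeIndex

lemma norm_nodeStep_le {f : ℝ → ℝ} {C : ℝ} (hC : ∀ x, ‖f x‖ ≤ C * (1 + x ^ 2)⁻¹) (t : ℝ)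
    {s : ℝ} (hs : 1 ≤ s) : ‖nodeStep f t s‖ ≤ 6 * C * (1 + (t - s) ^ 2)⁻¹ := by
  have hC0 : 0 ≤ C := by simpa using (norm_nonneg _).trans (hC 0)
  obtain ⟨h1, h2⟩ := mem_Ico_nodeIndex hs
  have h3 := sqrtNode_gap_le_one (nodeIndex s)
  set a := sqrtNode (nodeIndex s)
  -- As |s - a| ≤ 1, (t - s)² ≤ 2(t - a)² + 2. The final 6 is this 3 times the weight bound 2.
  have h4 : (1 + (t - a) ^ 2)⁻¹ ≤ 3 * (1 + (t - s) ^ 2)⁻¹ := by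
    rw [← div_eq_mul_inv, inv_le_comm₀ (by positivity) (by positivity), inv_div,
      div_le_iff₀ three_pos]
    have h5 : (s - a) ^ 2 ≤ 1 := by nlinarith
    nlinarith [sq_nonneg ((t - a) + (s - a)), sq_nonneg (t - a)]
  rw [nodeStep, norm_mul, Real.norm_of_nonneg (nodeWeight_nonneg _)]
  calc nodeWeight (nodeIndex s) * ‖f (t - a)‖
      ≤ 2 * (C * (3 * (1 + (t - s) ^ 2)⁻¹)) :=
        mul_le_mul (nodeWeight_le_two _) ((hC _).trans (mul_le_mul_of_nonneg_left h4 hC0))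
          (norm_nonneg _) two_pos.le
    _ = 6 * C * (1 + (t - s) ^ 2)⁻¹ := by ring

lemma integrableOn_nodeStep {f : ℝ → ℝ} {C : ℝ}
    (hC : ∀ x, ‖f x‖ ≤ C * (1 + x ^ 2)⁻¹) (t : ℝ) :
    IntegrableOn (nodeStep f t) (Set.Ici 1) := by
  have h := (integrable_inv_one_add_sq.const_mul (6 * C)).comp_sub_left t
  refine h.integrableOn.mono' (measurable_nodeStep f t).aestronglyMeasurable ?_
  filter_upwards [ae_restrict_mem measurableSet_Ici] with s hs
  exact norm_nodeStep_le hC t hs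

theorem hasSum_sqrtNode {f : ℝ → ℝ} {C : ℝ}
    (hC : ∀ x, ‖f x‖ ≤ C * (1 + x ^ 2)⁻¹) (t : ℝ) :
    HasSum (fun n => (sqrtNode n)⁻¹ * f (t - sqrtNode n))
      (∫ s in Set.Ici 1, nodeStep f t s) := by
  have hi := integrableOn_nodeStep hC t
  rw [← iUnion_Ico_sqrtNode] at hi ⊢
  have h := hasSum_integral_iUnion (fun n => measurableSet_Ico)
    sqrtNode_strictMono.monotone.pairwise_disjoint_on_Ico_succ hi
  refine h.congr_fun fun n => ?_
  have h1 : ∫ s in Set.Ico (sqrtNode n) (sqrtNode (n + 1)), nodeStep f t s =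
      ∫ s in Set.Ico (sqrtNode n) (sqrtNode (n + 1)), nodeWeight n * f (t - sqrtNode n) := by
    refine setIntegral_congr_fun measurableSet_Ico fun s hs => ?_
    simp only [nodeStep, (nodeIndex_eq_iff ((one_le_sqrtNode n).trans hs.1) n).2 hs]
  have h2 := (sqrtNode_strictMono n.lt_succ_self).le
  simp only [Nat.succ_eq_add_one] at h2
  rw [Order.succ_eq_add_one, h1, setIntegral_const, Real.volume_real_Ico_of_le h2, smul_eq_mul,
    ← mul_assoc, gap_mul_nodeWeight]

theorem tendsto_tsum_sqrtNode {f : ℝ → ℝ} (hf : Continuous f) {C : ℝ}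
    (hC : ∀ x, ‖f x‖ ≤ C * (1 + x ^ 2)⁻¹) :
    Tendsto (fun t => ∑' n, (sqrtNode n)⁻¹ * f (t - sqrtNode n)) atTop (𝓝 (∫ x, f x)) := by
  have h : ∀ t, ∑' n, (sqrtNode n)⁻¹ * f (t - sqrtNode n) =
      ∫ u, (Set.Ici 1).indicator (nodeStep f t) (t - u) := fun t => by
    rw [(hasSum_sqrtNode hC t).tsum_eq, integral_sub_left_eq_self, integral_indicator
      measurableSet_Ici]
  simp only [h]
  refine tendsto_integral_filter_of_dominated_convergence (fun u => 6 * C * (1 + u ^ 2)⁻¹) ?_ ?_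
    (integrable_inv_one_add_sq.const_mul _) ?_
  · exact .of_forall fun t => (((measurable_nodeStep f t).indicator measurableSet_Ici).comp
      (measurable_const.sub measurable_id)).aestronglyMeasurable
  · refine .of_forall fun t => .of_forall fun u => ?_
    by_cases hs : t - u ∈ Set.Ici 1
    · rw [Set.indicator_of_mem hs]
      simpa using norm_nodeStep_le hC t hs
    · have hC0 : 0 ≤ C := by simpa using (norm_nonneg _).trans (hC 0)
      rw [Set.indicator_of_notMem hs, norm_zero]
      positivity
  · refine .of_forall fun u => ?_
    have hu : Tendsto (fun t : ℝ => t - u) atTop atTop :=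
      tendsto_atTop_add_const_right _ _ tendsto_id
    -- With s = t - u and a the node below s, the sample point is t - a = u + (s - a), which tends
    -- to u.
    have h1 := (tendsto_sub_sqrtNode_nodeIndex.comp hu).add_const u
    rw [zero_add] at h1
    have h2 := (tendsto_nodeWeight.comp (tendsto_nodeIndex.comp hu)).mul
      ((hf.tendsto u).comp h1)
    rw [one_mul] at h2
    refine h2.congr' ?_
    filter_upwards [hu.eventually_ge_atTop 1] with t ht
    rw [Set.indicator_of_mem (Set.mem_Ici.2 ht)]
    simp only [nodeStep, Function.comp_apply]
    congr 2
    ring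

lemma unitaryFourier_eq_fourier (g : ℝ → ℂ) (x : ℝ) :
    unitaryFourier g x =
      (((2 * Real.pi) ^ (-(1 / 2) : ℝ) : ℝ) : ℂ) *
        FourierTransform.fourier g (x / (2 * Real.pi)) := by
  rw [unitaryFourier, Real.fourier_real_eq_integral_exp_smul]
  congr 1
  refine integral_congr_ae (.of_forall fun y => ?_)
  simp only [smul_eq_mul]
  congr 2
  push_cast
  have : (Real.pi : ℂ) ≠ 0 := by exact_mod_cast Real.pi_ne_zero
  field_simp

lemma SchwartzMap.exists_norm_sq_le (G : SchwartzMap ℝ ℂ) :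
    ∃ C, ∀ x, ‖G x‖ ^ 2 ≤ C * (1 + x ^ 2)⁻¹ := by
  obtain ⟨A, -, hA⟩ := G.decay 0 0
  obtain ⟨B, -, hB⟩ := G.decay 1 0
  refine ⟨A ^ 2 + B ^ 2, fun x => ?_⟩
  have h1 := hA x
  have h2 := hB x
  simp only [pow_zero, one_mul, pow_one, norm_iteratedFDeriv_zero] at h1 h2
  rw [← div_eq_mul_inv, le_div_iff₀ (by positivity)]
  have h3 := pow_le_pow_left₀ (norm_nonneg _) h1 2
  have h4 := pow_le_pow_left₀ (by positivity) h2 2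
  rw [mul_pow, Real.norm_eq_abs, sq_abs] at h4
  linarith

lemma continuous_and_decay_unitaryFourier {g : ℝ → ℂ} (hg : ContDiff ℝ ∞ g)
    (hgc : HasCompactSupport g) :
    Continuous (unitaryFourier g) ∧
      ∃ C, ∀ x, ‖unitaryFourier g x‖ ^ 2 ≤ C * (1 + x ^ 2)⁻¹ := by
  set G := FourierTransform.fourier (hgc.toSchwartzMap hg)
  have h : ∀ x, unitaryFourier g x =
      (((2 * Real.pi) ^ (-(1 / 2) : ℝ) : ℝ) : ℂ) * G (x / (2 * Real.pi)) :=
    unitaryFourier_eq_fourier g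
  refine ⟨by rw [funext h]; fun_prop, ?_⟩
  obtain ⟨C, hC⟩ := G.exists_norm_sq_le
  have hC0 : 0 ≤ C := by simpa using (sq_nonneg _).trans (hC 0)
  set c : ℂ := (((2 * Real.pi) ^ (-(1 / 2) : ℝ) : ℝ) : ℂ)
  refine ⟨‖c‖ ^ 2 * (C * (2 * Real.pi) ^ 2), fun x => ?_⟩
  rw [h, norm_mul, mul_pow, mul_assoc]
  gcongr
  refine (hC _).trans ?_
  rw [mul_assoc]
  gcongr
  -- The rescaling costs (2π)², since 1 + x² ≤ (2π)² + x².
  have hpi : 1 ≤ 2 * Real.pi := by linarith [Real.pi_gt_three]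
  rw [← div_eq_mul_inv, inv_le_comm₀ (by positivity) (by positivity), inv_div,
    div_le_iff₀ (by positivity), add_mul, div_pow, div_mul_cancel₀ _ (by positivity)]
  nlinarith

lemma eLpNorm_two_toReal_sq {f : ℝ → ℂ} (hf : MemLp f 2 volume) :
    (eLpNorm f 2 volume).toReal ^ 2 = ∫ x, ‖f x‖ ^ 2 := by
  rw [hf.eLpNorm_eq_integral_rpow_norm two_ne_zero ENNReal.ofNat_ne_top,
    ENNReal.toReal_ofReal (by positivity), ← Real.rpow_natCast, ← Real.rpow_mul (by positivity)]
  simp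

lemma rpow_neg_half_eq_inv_sqrtNode (n : ℕ) :
    (2 * (n : ℝ) + 1) ^ (-(1 / 2) : ℝ) = (sqrtNode n)⁻¹ := by
  rw [Real.rpow_neg (by positivity), ← Real.sqrt_eq_rpow, sqrtNode]

theorem mainTheorem8 (g : ℝ → ℂ) (hg : ContDiff ℝ ∞ g) (hgc : HasCompactSupport g) :
    MemLp (unitaryFourier g) 2 volume ∧
    (∀ t : ℝ, Summable fun n : ℕ =>
      (2 * (n : ℝ) + 1) ^ (-(1 / 2) : ℝ) *
        ‖unitaryFourier g (t - Real.sqrt (2 * (n : ℝ) + 1))‖ ^ 2) ∧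
    (∀ t : ℝ, Summable fun n : ℕ =>
      (2 * (n : ℝ) + 1) ^ (-(1 / 2) : ℝ) *
        ‖unitaryFourier g (t + Real.sqrt (2 * (n : ℝ) + 1))‖ ^ 2) ∧
    Tendsto (fun t : ℝ => ∑' n : ℕ,
        (2 * (n : ℝ) + 1) ^ (-(1 / 2) : ℝ) *
          ‖unitaryFourier g (t - Real.sqrt (2 * (n : ℝ) + 1))‖ ^ 2)
      atTop (𝓝 ((eLpNorm (unitaryFourier g) 2 volume).toReal ^ 2)) ∧
    Tendsto (fun t : ℝ => ∑' n : ℕ,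
        (2 * (n : ℝ) + 1) ^ (-(1 / 2) : ℝ) *
          ‖unitaryFourier g (t + Real.sqrt (2 * (n : ℝ) + 1))‖ ^ 2)
      atBot (𝓝 ((eLpNorm (unitaryFourier g) 2 volume).toReal ^ 2)) := by
  obtain ⟨hcont, C, hC⟩ := continuous_and_decay_unitaryFourier hg hgc
  set F := unitaryFourier g
  have hf : Continuous fun x => ‖F x‖ ^ 2 := by fun_prop
  have hf' : Continuous fun x => ‖F (-x)‖ ^ 2 := by fun_prop
  have hb : ∀ x, ‖‖F x‖ ^ 2‖ ≤ C * (1 + x ^ 2)⁻¹ := fun x => by simpa using hC x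
  have hb' : ∀ x, ‖‖F (-x)‖ ^ 2‖ ≤ C * (1 + x ^ 2)⁻¹ := fun x => by simpa using hC (-x)
  have hL : MemLp F 2 volume := by
    rw [memLp_two_iff_integrable_sq_norm hcont.aestronglyMeasurable]
    exact (integrable_inv_one_add_sq.const_mul C).mono' hf.aestronglyMeasurable (.of_forall hb)
  have hneg : ∀ t s : ℝ, -(-t - s) = t + s := fun t s => by ring
  simp only [eLpNorm_two_toReal_sq hL, rpow_neg_half_eq_inv_sqrtNode]
  refine ⟨hL, fun t => (hasSum_sqrtNode hb t).summable, fun t => ?_,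
    tendsto_tsum_sqrtNode hf hb, ?_⟩
  -- The `+` series at t is the `-` series at -t for the reflected function x ↦ F (-x).
  · have h := (hasSum_sqrtNode hb' (-t)).summable
    simp only [hneg] at h
    exact h
  · have h := (tendsto_tsum_sqrtNode hf' hb').comp tendsto_neg_atBot_atTop
    rw [integral_neg_eq_self (fun x => ‖F x‖ ^ 2)] at h
    simp only [Function.comp_def, hneg] at h
    exact h
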